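/- Let $K$ be an algebraically closed field of characteristic $0$, let $L$ be a finite-dimensional Lie algebra over $K$ with center $Z$, and let $J$ be a Lie-orthogonal operator on $L$, i.e. a linear map $J\colon L\to L$ with $[Jx,Jy]=[x,y]$ for all $x,y\in L$. Suppose that $1$ is an eigenvalue of $J$, let $L_1$ be the generalized eigenspace of $J$ for the eigenvalue $1$, and put $I_1=L_1+Z$ (a sum of subspaces, not necessarily direct). Then $I_1$ is a $J$-invariant ideal of $L$, and the restriction $J_1=J|_{I_1}$, which is a Lie-orthogonal operator on the Lie algebra $I_1$, is equivalent to an operator of the form $\mathrm{Id}_{I_1}+N$, where $N$ is a nilpotent linear operator on $I_1$ whose image is contained in the radical $R_1$ (the largest solvable ideal) of $I_1$. Here two Lie-orthogonal operators on a Lie algebra are called equivalent if the image of their difference is contained in the center of that algebra; in particular $\mathrm{Id}_{I_1}+N$ is itself a Lie-orthogonal operator on $I_1$. -/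

import Mathlib

/-- A linear operator `J` on a Lie algebra `L` is Lie-orthogonal if `[J x, J y] = [x, y]` for all
`x, y` in `L`. -/
def IsLieOrthogonal {K L : Type*} [CommRing K] [LieRing L] [LieAlgebra K L]
    (J : Module.End K L) : Prop :=
  ∀ x y : L, ⁅J x, J y⁆ = ⁅x, y⁆

/-- Two Lie-orthogonal operators on a Lie algebra are equivalent if the image of their difference
is contained in the center of this algebra. -/
structure LieOrthogonalEquivalent {K L : Type*} [CommRing K] [LieRing L] [LieAlgebra K L]
    (J J' : Module.End K L) : Prop where
  left : IsLieOrthogonal J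
  right : IsLieOrthogonal J'
  range_sub_le : LinearMap.range (J - J') ≤ (LieAlgebra.center K L).toSubmodule

open Classical in
/-- The subspace `I_lam` attached to a scalar `lam` and an operator `J`: it is `Z` if `lam = 0`,
`L_lam + Z` if `lam = 1` or `lam = -1`, and `L_lam + L_(lam⁻¹) + Z` otherwise, where `L_lam` is the
generalized eigenspace of `J` for `lam` and `Z` is the center of `L`. The sums are sums of
subspaces (`L_lam` and `Z` may intersect). -/
noncomputable def eigenIdealSpace {K L : Type*} [Field K] [LieRing L] [LieAlgebra K L]
    (J : Module.End K L) (lam : K) : Submodule K L :=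
  if lam = 0 then (LieAlgebra.center K L).toSubmodule
  else if lam = 1 ∨ lam = -1 then
    J.maxGenEigenspace lam ⊔ (LieAlgebra.center K L).toSubmodule
  else
    J.maxGenEigenspace lam ⊔ J.maxGenEigenspace lam⁻¹ ⊔ (LieAlgebra.center K L).toSubmodule

namespace IsLieOrthogonal

section CommRing

variable {K L : Type*} [CommRing K] [LieRing L] [LieAlgebra K L] {J : Module.End K L}

/-! Expanding [Jx, Jy] = [x, y] shows that L_a and L_b commute unless ab = 1. Hence L_1 commutes
with all other generalized eigenspaces, which makes L_1 + Z an ideal; on it J - 1 is nilpotent up to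
central values. For the radical, let P = 1 + N be Lie-orthogonal with N nilpotent. Invariance of the
Killing form κ makes κ((P - P⁻¹)x, [y, z]) symmetric in x, y; being alternating in y, z, it
vanishes. So P - P⁻¹ maps into [L, L]^⊥, which is solvable by Cartan's criterion. Since P - P⁻¹ =
N(2 + N)P⁻¹ with 2 + N and P invertible, N has the same image. -/

lemma pow (hJ : IsLieOrthogonal J) (n : ℕ) : IsLieOrthogonal (J ^ n) := by
  induction n with
  | zero => intro x y; simp
  | succ n ih =>
    intro x y
    rw [pow_succ', Module.End.mul_apply, Module.End.mul_apply, hJ, ih]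

/-- An operator that differs from a Lie-orthogonal one by central values is Lie-orthogonal. -/
lemma of_range_sub_le_center {J' : Module.End K L} (hJ : IsLieOrthogonal J)
    (h : LinearMap.range (J - J') ≤ (LieAlgebra.center K L).toSubmodule) :
    IsLieOrthogonal J' := by
  have hc (x y : L) : ⁅y, (J - J') x⁆ = 0 :=
    (LieModule.mem_maxTrivSubmodule K L L _).1 (h (LinearMap.mem_range_self _ x)) y
  have hc' (x y : L) : ⁅(J - J') x, y⁆ = 0 := by rw [← lie_skew, hc, neg_zero]
  intro x y
  have e (z : L) : J' z = J z - (J - J') z := by simp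
  rw [e x, sub_lie, hc', sub_zero, e y, lie_sub, hc, sub_zero, hJ]

end CommRing

section Field

variable {K L : Type*} [Field K] [LieRing L] [LieAlgebra K L] {J : Module.End K L}

/-- The generalized eigenspaces of a Lie-orthogonal operator for `a` and `b` commute unless
`a * b = 1`. -/
lemma lie_eq_zero_of_mem_maxGenEigenspace (hJ : IsLieOrthogonal J) {a b : K} (hab : a * b ≠ 1)
    {x y : L} (hx : x ∈ J.maxGenEigenspace a) (hy : y ∈ J.maxGenEigenspace b) : ⁅x, y⁆ = 0 := by
  rw [Module.End.mem_maxGenEigenspace] at hx hy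
  obtain ⟨k, hk⟩ := hx
  obtain ⟨l, hl⟩ := hy
  induction k generalizing x y l with
  | zero => simp_all
  | succ k ihk =>
    induction l generalizing y with
    | zero => simp_all
    | succ l ihl =>
      rw [pow_succ, Module.End.mul_apply] at hk hl
      -- With x' = (J - a)x and y' = (J - b)y, the brackets [x, y'], [x', y], [x', y'] vanish by
      -- induction, leaving ab[x, y] = [x, y].
      have h1 := ihl hl
      have h2 := ihk hk (l + 1) (by rwa [pow_succ, Module.End.mul_apply])
      have h3 := ihk hk l hl
      have ex : J x = a • x + (J - a • 1) x := by simp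
      have ey : J y = b • y + (J - b • 1) y := by simp
      have h := hJ x y
      rw [ex, ey] at h
      simp only [add_lie, lie_add, smul_lie, lie_smul, h1, h2, h3, smul_zero, add_zero,
        smul_smul] at h
      have h' : (a * b - 1) • ⁅x, y⁆ = 0 := by
        rw [sub_smul, one_smul, mul_comm, h, sub_self]
      exact (smul_eq_zero.1 h').resolve_left (sub_ne_zero.2 hab)

variable [FiniteDimensional K L]

/-- J need not be surjective, so the Fitting decomposition of L for J is used: ker Jᵐ is central,
and on im Jᵐ with m ≥ 1 one factor J cancels from the bracket. -/
lemma map_mem_center (hJ : IsLieOrthogonal J) {z : L} (hz : z ∈ LieAlgebra.center K L) :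
    J z ∈ LieAlgebra.center K L := by
  have hz' (y : L) : ⁅y, z⁆ = 0 := (LieModule.mem_maxTrivSubmodule K L L z).1 hz y
  refine (LieModule.mem_maxTrivSubmodule K L L _).2 fun y ↦ ?_
  obtain ⟨n, hn⟩ := Filter.eventually_atTop.1 J.eventually_codisjoint_ker_pow_range_pow
  have hy : y ∈ LinearMap.ker (J ^ (n + 1)) ⊔ LinearMap.range (J ^ (n + 1)) :=
    (hn (n + 1) n.le_succ).eq_top ▸ Submodule.mem_top
  obtain ⟨u, hu, _, ⟨v, rfl⟩, rfl⟩ := Submodule.mem_sup.1 hy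
  rw [add_lie, ← hJ.pow (n + 1) u, LinearMap.mem_ker.1 hu, zero_lie, zero_add, pow_succ',
    Module.End.mul_apply, hJ, hz']

/-- In characteristic zero, the nilpotent part of a unipotent Lie-orthogonal operator takes values
in the solvable radical. -/
lemma range_le_radical_of_isNilpotent [CharZero K] {N : Module.End K L} (hN : IsNilpotent N)
    (h : IsLieOrthogonal (1 + N)) :
    LinearMap.range N ≤ (LieAlgebra.radical K L).toSubmodule := by
  obtain ⟨U, hU⟩ := hN.isUnit_one_add
  set V : Module.End K L := ↑U⁻¹ with hV
  have hUV (x : L) : (1 + N) (V x) = x := by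
    rw [← hU, hV, ← Module.End.mul_apply, Units.mul_inv, Module.End.one_apply]
  have key (x y z : L) : killingForm K L ((1 + N) x) ⁅y, z⁆ = -killingForm K L (V y) ⁅x, z⁆ := by
    rw [← LieModule.traceForm_apply_lie_apply, ← LieModule.traceForm_apply_lie_apply,
      ← lie_skew (V y) x, map_neg, LinearMap.neg_apply, neg_neg, ← h x, hUV]
  let g (x y z : L) : K := killingForm K L ((1 + N - V) x) ⁅y, z⁆
  have hsymm (x y z : L) : g x y z = g y x z := by
    simp only [g, LinearMap.sub_apply, map_sub, key x y z, key y x z]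
    ring
  have hanti (x y z : L) : g x y z = -g x z y := by
    simp only [g]
    rw [← lie_skew, map_neg]
  have hzero (x y z : L) : g x y z = 0 := by
    -- A swap of each kind cycles the arguments with sign -1; three cycles restore the order with
    -- total sign -1.
    have : g x y z = -g x y z := calc
      g x y z = -g y z x := by rw [hsymm, hanti]
      _ = g z x y := by rw [hsymm, hanti, neg_neg]
      _ = -g x y z := by rw [hsymm, hanti]
    exact self_eq_neg.1 this
  let S : LieIdeal K L := LieIdeal.killingCompl K L ⁅(⊤ : LieIdeal K L), (⊤ : LieIdeal K L)⁆
  have hS : S ≤ LieAlgebra.radical K L := by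
    rw [← LieAlgebra.LieIdeal.solvable_iff_le_radical]
    refine LieIdeal.isSolvable_of_killingForm_apply_lie_eq_zero _ fun x hx y hy ↦ ?_
    rw [LieModule.traceForm_comm]
    exact (LieIdeal.mem_killingCompl K L _).1 hx y (LieSubmodule.mono_lie le_top le_top hy)
  have hrange (x : L) : (1 + N - V) x ∈ S := by
    refine (LieIdeal.mem_killingCompl K L _).2 fun d hd ↦ ?_
    rw [← LieSubmodule.mem_toSubmodule, LieSubmodule.lieIdeal_oper_eq_linear_span'] at hd
    rw [LieModule.traceForm_comm]
    induction hd using Submodule.span_induction with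
    | mem d hd =>
      obtain ⟨y, -, z, -, rfl⟩ := hd
      exact hzero x y z
    | zero => simp
    | add d e _ _ hd he => rw [map_add, hd, he, add_zero]
    | smul c d _ hd => rw [map_smul, hd, smul_zero]
  have htwo : IsUnit (2 : Module.End K L) := by
    simpa only [map_ofNat] using (isUnit_iff_ne_zero.2 (two_ne_zero (α := K))).map (algebraMap K (Module.End K L))
  obtain ⟨W, hW⟩ : IsUnit (2 + N) :=
    hN.isUnit_add_left_of_commute htwo (Commute.ofNat_right N 2)
  have hfac : N = (1 + N - V) * ((1 + N) * ↑W⁻¹) := by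
    have e : (1 + N - V) * (1 + N) = N * (2 + N) := by
      rw [sub_mul, ← hU, hV, Units.inv_mul, hU]
      noncomm_ring
    rw [← mul_assoc, e, ← hW, mul_assoc, Units.mul_inv, mul_one]
  rintro _ ⟨x, rfl⟩
  rw [hfac, Module.End.mul_apply]
  exact hS (hrange _)

/-- The sum of the generalized eigenspace for `1` and the center absorbs brackets. -/
lemma lie_mem_maxGenEigenspace_one_sup_center [IsAlgClosed K] (hJ : IsLieOrthogonal J) (x : L)
    {y : L} (hy : y ∈ J.maxGenEigenspace 1 ⊔ (LieAlgebra.center K L).toSubmodule) :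
    ⁅x, y⁆ ∈ J.maxGenEigenspace 1 ⊔ (LieAlgebra.center K L).toSubmodule := by
  set W : Submodule K L := ⨆ (b : K) (_ : b ≠ 1), J.maxGenEigenspace b with hW
  have htop (v : L) : ∃ u ∈ J.maxGenEigenspace 1, ∃ w ∈ W, u + w = v := by
    refine Submodule.mem_sup.1 ?_
    have : (⨆ b, J.maxGenEigenspace b) ≤ J.maxGenEigenspace 1 ⊔ W := by
      refine iSup_le fun b ↦ ?_
      by_cases hb : b = 1
      · exact hb ▸ le_sup_left
      · exact le_sup_of_le_right (le_iSup₂_of_le b hb le_rfl)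
    exact this (J.iSup_maxGenEigenspace_eq_top ▸ Submodule.mem_top)
  have hcomm {u w : L} (hu : u ∈ J.maxGenEigenspace 1) (hw : w ∈ W) : ⁅u, w⁆ = 0 := by
    have : W ≤ LinearMap.ker (LieAlgebra.ad K L u : L →ₗ[K] L) :=
      iSup₂_le fun b hb w hw ↦
        hJ.lie_eq_zero_of_mem_maxGenEigenspace (by rwa [one_mul]) hu hw
    exact this hw
  have hcomm' {u w : L} (hu : u ∈ J.maxGenEigenspace 1) (hw : w ∈ W) : ⁅w, u⁆ = 0 := by
    rw [← lie_skew, hcomm hu hw, neg_zero]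
  obtain ⟨y, hy₁, z, hz, rfl⟩ := Submodule.mem_sup.1 hy
  obtain ⟨x, hx, w, hw, rfl⟩ := htop x
  rw [lie_add, (LieModule.mem_maxTrivSubmodule K L L z).1 hz, add_zero, add_lie, hcomm' hy₁ hw,
    add_zero]
  obtain ⟨u, hu, v, hv, huv⟩ := htop ⁅x, y⁆
  rw [← huv]
  -- The component v in W is central: it commutes with L_1, and with W because [x, y] (by Jacobi)
  -- and u both do.
  refine Submodule.add_mem_sup hu ((LieModule.mem_maxTrivSubmodule K L L v).2 fun t ↦ ?_)
  obtain ⟨t, ht, s, hs, rfl⟩ := htop t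
  have hxy : ⁅s, ⁅x, y⁆⁆ = 0 := by
    rw [leibniz_lie, hcomm' hx hs, hcomm' hy₁ hs, zero_lie, lie_zero, add_zero]
  rw [← huv, lie_add, hcomm' hu hs, zero_add] at hxy
  rw [add_lie, hcomm ht hv, hxy, add_zero]

end Field

end IsLieOrthogonal

/-- A submodule that together with `B` spans everything has a complement inside `B`. -/
lemma Submodule.exists_isCompl_le_of_sup_eq_top {K V : Type*} [Field K] [AddCommGroup V]
    [Module K V] {A B : Submodule K V} (h : A ⊔ B = ⊤) : ∃ C ≤ B, IsCompl A C := by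
  obtain ⟨D, hD⟩ := exists_isCompl (A ⊓ B)
  refine ⟨D ⊓ B, inf_le_right, ?_, ?_⟩
  · rw [disjoint_iff, ← hD.inf_eq_bot]
    ac_rfl
  · rw [codisjoint_iff, eq_top_iff, ← h]
    have : B ≤ A ⊓ B ⊔ D ⊓ B := by
      rw [← sup_inf_assoc_of_le D inf_le_right, hD.sup_eq_top, top_inf_eq]
    exact sup_le le_sup_left (this.trans (sup_le_sup_right inf_le_left _))

/-- If `T` is nilpotent on an invariant subspace `A` and `V = A ⊕ C`, then the operator that equals
`T` on `A` and `0` on `C` is nilpotent. -/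
lemma Module.End.isNilpotent_mul_projection {K V : Type*} [Field K] [AddCommGroup V] [Module K V]
    {A C : Submodule K V} (hAC : IsCompl A C) {T : Module.End K V} (hTA : ∀ x ∈ A, T x ∈ A)
    {n : ℕ} (hn : ∀ x ∈ A, (T ^ n) x = 0) : IsNilpotent (T * A.projection C hAC) := by
  have hpow (m : ℕ) (x : V) (hx : x ∈ A) :
      ((T * A.projection C hAC) ^ m) x = (T ^ m) x := by
    induction m generalizing x with
    | zero => simp
    | succ m ih =>
      rw [pow_succ, Module.End.mul_apply, Module.End.mul_apply,
        (Submodule.projection_eq_self_iff hAC x).2 hx, ih _ (hTA x hx), pow_succ,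
        Module.End.mul_apply]
  -- The extra factor first moves x into A.
  refine ⟨n + 1, LinearMap.ext fun x ↦ ?_⟩
  have hx : (T * A.projection C hAC) x ∈ A := hTA _ (Submodule.projection_apply_mem hAC x)
  rw [pow_succ, Module.End.mul_apply, hpow n _ hx, hn _ hx, LinearMap.zero_apply]

theorem proposition9 {K L : Type*} [Field K] [IsAlgClosed K] [CharZero K]
    [LieRing L] [LieAlgebra K L] [FiniteDimensional K L]
    (J : Module.End K L) (hJ : IsLieOrthogonal J) (h1 : J.HasEigenvalue 1) :
    ∃ I : LieIdeal K L, I.toSubmodule = eigenIdealSpace J 1 ∧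
      ∃ J₁ : Module.End K I, (∀ x : I, ((J₁ x : I) : L) = J (x : L)) ∧
        ∃ N : Module.End K I, IsNilpotent N ∧
          LinearMap.range N ≤ (LieAlgebra.radical K I).toSubmodule ∧
          LieOrthogonalEquivalent J₁ (LinearMap.id + N) := by
  let I : LieIdeal K L :=
    { J.maxGenEigenspace 1 ⊔ (LieAlgebra.center K L).toSubmodule with
      lie_mem := fun {x} _ hy ↦ hJ.lie_mem_maxGenEigenspace_one_sup_center x hy }
  have hI : I.toSubmodule = J.maxGenEigenspace 1 ⊔ (LieAlgebra.center K L).toSubmodule := rfl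
  have hJ1 : ∀ x ∈ J.maxGenEigenspace 1, J x ∈ J.maxGenEigenspace 1 :=
    Module.End.mapsTo_maxGenEigenspace_of_comm (Commute.refl J) 1
  have hJI : ∀ x ∈ I.toSubmodule, J x ∈ I.toSubmodule := by
    rw [hI]
    intro x hx
    obtain ⟨y, hy, z, hz, rfl⟩ := Submodule.mem_sup.1 hx
    rw [map_add]
    exact Submodule.add_mem_sup (hJ1 y hy) (hJ.map_mem_center hz)
  let J₁ : Module.End K I := J.restrict hJI
  have hJ₁ (x : I) : ((J₁ x : I) : L) = J (x : L) := rfl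
  have hJ₁orth : IsLieOrthogonal J₁ := fun x y ↦ Subtype.ext (hJ x y)
  let A : Submodule K I := (J.maxGenEigenspace 1).comap I.toSubmodule.subtype
  let B : Submodule K I := (LieAlgebra.center K L).toSubmodule.comap I.toSubmodule.subtype
  have hAB : A ⊔ B = ⊤ := by
    refine eq_top_iff.2 fun x _ ↦ ?_
    obtain ⟨y, hy, z, hz, hyz⟩ := Submodule.mem_sup.1 (show (x : L) ∈ I.toSubmodule from x.2)
    exact Submodule.mem_sup.2 ⟨⟨y, Submodule.mem_sup_left hy⟩, hy, ⟨z, Submodule.mem_sup_right hz⟩,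
      hz, Subtype.ext hyz⟩
  -- L_1 and Z may intersect, so the complement C of L_1 is chosen inside Z. There J₁ - 1 has
  -- central values, and replacing it by 0 on C gives an equivalent operator.
  obtain ⟨C, hCB, hAC⟩ := Submodule.exists_isCompl_le_of_sup_eq_top hAB
  have hTA : ∀ x ∈ A, (J₁ - 1) x ∈ A := fun x hx ↦ sub_mem (hJ1 x hx) hx
  have hTB : ∀ x ∈ B, (J₁ - 1) x ∈ B := fun x hx ↦ sub_mem (hJ.map_mem_center hx) hx
  have hTpow (n : ℕ) (x : I) : (((J₁ - 1) ^ n) x : L) = ((J - 1) ^ n) (x : L) := by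
    induction n generalizing x with
    | zero => simp
    | succ n ih => rw [pow_succ, Module.End.mul_apply, ih, pow_succ, Module.End.mul_apply]; rfl
  have hTn : ∀ x ∈ A, ((J₁ - 1) ^ Module.finrank K L) x = 0 := by
    intro x hx
    have hx' : (x : L) ∈ J.maxGenEigenspace 1 := hx
    rw [Module.End.maxGenEigenspace_eq_genEigenspace_finrank, Module.End.mem_genEigenspace_nat,
      LinearMap.mem_ker, one_smul] at hx'
    exact Subtype.ext ((hTpow _ x).trans hx')
  have hN : IsNilpotent ((J₁ - 1) * A.projection C hAC) :=
    Module.End.isNilpotent_mul_projection hAC hTA hTn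
  have hB : B ≤ (LieAlgebra.center K I).toSubmodule := fun x hx ↦
    (LieModule.mem_maxTrivSubmodule K I I x).2 fun y ↦
      Subtype.ext ((LieModule.mem_maxTrivSubmodule K L L (x : L)).1 hx y)
  have hrange : LinearMap.range (J₁ - (1 + (J₁ - 1) * A.projection C hAC)) ≤
      (LieAlgebra.center K I).toSubmodule := by
    rintro _ ⟨x, rfl⟩
    have e : (J₁ - (1 + (J₁ - 1) * A.projection C hAC)) x = (J₁ - 1) (x - A.projection C hAC x) := by
      simp only [LinearMap.sub_apply, LinearMap.add_apply, Module.End.mul_apply, map_sub,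
        Module.End.one_apply]
      abel
    rw [e]
    refine hB (hTB _ (hCB ?_))
    rw [← eq_sub_of_add_eq' (Submodule.projection_add_projection_eq_self hAC x)]
    exact Submodule.projection_apply_mem _ x
  -- The Killing form argument is then applied to I itself, so the radical obtained is that of I.
  have horth := hJ₁orth.of_range_sub_le_center hrange
  refine ⟨I, by rw [hI, eigenIdealSpace, if_neg one_ne_zero, if_pos (Or.inl rfl)], J₁, hJ₁, _, hN,
    IsLieOrthogonal.range_le_radical_of_isNilpotent hN horth, hJ₁orth, horth, hrange⟩
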